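/- There is an absolute constant $\kappa>0$ such that the following holds. Let $A\in\{0,1\}^{m\times n}$, let $c\in[0,1]^n$ be objective weights (in particular, weights normalised so that $\max_j c_j=1$), and let $B\ge 1$. Let $x'\in[0,1]^n$ satisfy $Ax'\le B$ in every row (for instance, let $x'$ be an optimum of the linear program $\max\{\sum_j c_jx_j : Ax\le B,\ 0\le x\le 1\}$), and write $\mathrm{OPT}=\sum_j c_jx'_j$. Let $U\subseteq\{1,\dots,n\}$ be any set of columns (for instance all columns, or the variables that are still unfixed after a sparsification phase), and let $d$ be the dependency degree of the constraints on the columns $U$: the maximum, over the rows $r$, of the number of rows $s\ne r$ for which some column $j\in U$ has $A_{rj}=A_{sj}=1$. (i) If $B>1$ is real, then $x'$ can be rounded to a vector $\hat x\in\{0,1\}^n$, with $\hat x_j=0$ whenever $x'_j=0$, such that $$\|A\hat x\|_\infty\le B\qquad\text{and}\qquad \sum_j c_j\hat x_j\ \ge\ \kappa\,\frac{\mathrm{OPT}}{S},\qquad S=\max\left\{1,\ \left(\frac{m}{\mathrm{OPT}}\right)^{\frac1{B-1}},\ d^{\frac1{B-1}}\right\}.$$ (ii) If $B\ge1$ is an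 integer, then the same holds with $B$ replaced by $B+1$ in the expression for $S$, that is, with $$S=\max\left\{1,\ \left(\frac{m}{\mathrm{OPT}}\right)^{\frac1{B}},\ d^{\frac1{B}}\right\}.$$ (If $\mathrm{OPT}=0$ the bound on the objective value is read as $\sum_j c_j\hat x_j\ge 0$.) -/

import Mathlib

open scoped Matrix

noncomputable section

namespace PackingRounding

/-- All entries of the constraint matrix are `0` or `1`. -/
def IsZeroOne {ι κ : Type*} (A : Matrix ι κ ℝ) : Prop :=
  ∀ i j, A i j = 0 ∨ A i j = 1

/-- A feasible point of the linear relaxation `A x ≤ B`, `0 ≤ x ≤ 1`. -/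
def IsFractionalSolution {m n : ℕ} (A : Matrix (Fin m) (Fin n) ℝ) (B : ℝ)
    (x : Fin n → ℝ) : Prop :=
  (∀ j, 0 ≤ x j ∧ x j ≤ 1) ∧ ∀ i, (A *ᵥ x) i ≤ B

/-- The objective value `∑ c_j x_j`. -/
def objective {n : ℕ} (c x : Fin n → ℝ) : ℝ := ∑ j, c j * x j

/-- `y` is a `0/1` vector obtained by rounding `x`: a variable that is `0` in the fractional
solution is never rounded up. -/
def IsRounding {n : ℕ} (x y : Fin n → ℝ) : Prop :=
  (∀ j, y j = 0 ∨ y j = 1) ∧ ∀ j, x j = 0 → y j = 0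

/-- Two different constraints are dependent if some column has a `1` in both rows. -/
def Dependent {ι κ : Type*} (A : Matrix ι κ ℝ) (r s : ι) : Prop :=
  r ≠ s ∧ ∃ j, A r j = 1 ∧ A s j = 1

open Classical in
/-- The largest number of other constraints on which a single constraint depends. -/
def dependencyDegree {ι κ : Type*} [Fintype ι] (A : Matrix ι κ ℝ) : ℕ :=
  Finset.univ.sup fun r => (Finset.univ.filter fun s => Dependent A r s).card

/-- The constraint matrix projected to the columns in `U` (the variables that are still
unfixed). -/
def restrictColumns {m n : ℕ} (A : Matrix (Fin m) (Fin n) ℝ) (U : Finset (Fin n)) :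
    Matrix (Fin m) {j // j ∈ U} ℝ :=
  A.submatrix id Subtype.val

/-- The scaling factor `S = max {(m / OPT)^(1/(B-1)), d^(1/(B-1))}`, where `S ≥ 1`. -/
def scaling (m : ℕ) (OPT : ℝ) (d : ℕ) (B : ℝ) : ℝ :=
  max 1 (max (((m : ℝ) / OPT) ^ (1 / (B - 1))) ((d : ℝ) ^ (1 / (B - 1))))

end PackingRounding

end

namespace PackingRounding

section Multiaffine

variable {ι : Type*} [DecidableEq ι]

/-! This is randomized rounding with alteration, derandomized. With `b = ⌊B⌋`, scale the fractional
point to `p = x / (16 s)` and charge one unit for every `(b + 1)`-subset of a row that is entirely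
selected. Deleting an element from an overfull row costs at most one unit of weight and destroys at
least one such subset, so weight minus charge is a lower bound for the weight left after repair
(`exists_subset_card_inter_le`). The expected weight minus charge is multiaffine in `p`, so some
vertex of the cube does at least as well (`IsMultiaffine.exists_vertex`). The expected charge of a
row is an elementary symmetric sum, at most `(3 / (16 s)) ^ (b + 1)`. The only facts needed about
the scaling factor are `s ≥ 1` and `m / OPT ≤ s ^ b`; they make the total charge a fixed fraction,
below one, of the scaled weight. -/

/-- A function of several real variables that is affine in each of them separately. -/
def IsMultiaffine (F : (ι → ℝ) → ℝ) : Prop :=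
  ∀ p j, F p = (1 - p j) * F (Function.update p j 0) + p j * F (Function.update p j 1)

theorem IsMultiaffine.prod (T : Finset ι) : IsMultiaffine fun p : ι → ℝ => ∏ j ∈ T, p j := by
  intro p a
  by_cases ha : a ∈ T
  · simp only [Finset.prod_update_of_mem ha]
    rw [← Finset.mul_prod_erase T p ha, Finset.sdiff_singleton_eq_erase]
    ring
  · simp only [Finset.prod_update_of_notMem ha]
    ring

theorem IsMultiaffine.apply (i : ι) : IsMultiaffine fun p : ι → ℝ => p i := by
  simpa using IsMultiaffine.prod {i}

theorem IsMultiaffine.sum {α : Type*} (s : Finset α) {F : α → (ι → ℝ) → ℝ}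
    (h : ∀ i ∈ s, IsMultiaffine (F i)) : IsMultiaffine fun p => ∑ i ∈ s, F i p := by
  intro p a
  simp only [Finset.mul_sum, ← Finset.sum_add_distrib]
  exact Finset.sum_congr rfl fun i hi => h i hi p a

theorem IsMultiaffine.const_mul {F : (ι → ℝ) → ℝ} (h : IsMultiaffine F) (c : ℝ) :
    IsMultiaffine fun p => c * F p := by
  intro p a
  beta_reduce
  rw [h p a]
  ring

theorem IsMultiaffine.sub {F G : (ι → ℝ) → ℝ} (hF : IsMultiaffine F) (hG : IsMultiaffine G) :
    IsMultiaffine fun p => F p - G p := by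
  intro p a
  beta_reduce
  rw [hF p a, hG p a]
  ring

/-- The value of a multiaffine function at a point of the unit cube is at most its value at some
vertex whose support is contained in the support of the point. -/
theorem IsMultiaffine.exists_vertex [Fintype ι] {F : (ι → ℝ) → ℝ} (hF : IsMultiaffine F)
    (p : ι → ℝ) (hp : ∀ j, 0 ≤ p j ∧ p j ≤ 1) :
    ∃ S : Finset ι, (∀ j ∈ S, p j ≠ 0) ∧ F p ≤ F fun j => if j ∈ S then 1 else 0 := by
  have key : ∀ s : Finset ι, ∃ q : ι → ℝ, F p ≤ F q ∧ (∀ j, 0 ≤ q j ∧ q j ≤ 1) ∧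
      (∀ j ∈ s, q j = 0 ∨ q j = 1) ∧ ∀ j, p j = 0 → q j = 0 := by
    intro s
    induction s using Finset.induction_on with
    | empty => exact ⟨p, le_rfl, hp, by simp, fun _ h => h⟩
    | insert a s ha ih =>
      obtain ⟨q, hFq, hq, hqs, hqp⟩ := ih
      by_cases hqa : q a = 0
      · refine ⟨q, hFq, hq, fun j hj => ?_, hqp⟩
        rcases Finset.mem_insert.1 hj with rfl | hj
        · exact Or.inl hqa
        · exact hqs j hj
      have hpa : p a ≠ 0 := fun h => hqa (hqp a h)
      -- The value at `q` is a convex combination of the values at the two endpoints, so one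
      -- endpoint is at least as good.
      obtain ⟨v, hv, hFv⟩ : ∃ v : ℝ, (v = 0 ∨ v = 1) ∧ F q ≤ F (Function.update q a v) := by
        by_contra! h
        have h0 := h 0 (Or.inl rfl)
        have h1 := h 1 (Or.inr rfl)
        have hpos : 0 < q a := lt_of_le_of_ne (hq a).1 (Ne.symm hqa)
        have := hF q a
        nlinarith [mul_le_mul_of_nonneg_left h0.le (sub_nonneg.2 (hq a).2),
          mul_lt_mul_of_pos_left h1 hpos]
      refine ⟨Function.update q a v, hFq.trans hFv, fun j => ?_, fun j hj => ?_, fun j hj => ?_⟩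
      · by_cases hja : j = a
        · subst hja
          rcases hv with rfl | rfl <;> simp
        · simpa [hja] using hq j
      · by_cases hja : j = a
        · subst hja
          simpa using hv
        · simpa [hja] using hqs j (Finset.mem_of_mem_insert_of_ne hj hja)
      · have hja : j ≠ a := fun h => hpa (h ▸ hj)
        simpa [hja] using hqp j hj
  obtain ⟨q, hFq, -, hq, hqp⟩ := key Finset.univ
  refine ⟨Finset.univ.filter fun j => q j = 1, fun j hj hpj => ?_, hFq.trans_eq ?_⟩
  · simp [hqp j hpj] at hj
  · congr 1
    funext j
    rcases hq j (Finset.mem_univ j) with h | h <;> simp [h]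

end Multiaffine

/-- The elementary symmetric sum of degree `k` is at most `t⁻ᵏ exp (t ∑ p)`. -/
theorem pow_mul_sum_powersetCard_prod_le_exp {ι : Type*} (R : Finset ι) (k : ℕ) (p : ι → ℝ)
    (hp : ∀ j, 0 ≤ p j) {t : ℝ} (ht : 0 ≤ t) :
    t ^ k * ∑ T ∈ R.powersetCard k, ∏ j ∈ T, p j ≤ Real.exp (t * ∑ j ∈ R, p j) := by
  classical
  calc t ^ k * ∑ T ∈ R.powersetCard k, ∏ j ∈ T, p j
      = ∑ T ∈ R.powersetCard k, ∏ j ∈ T, t * p j := by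
        rw [Finset.mul_sum]
        refine Finset.sum_congr rfl fun T hT => ?_
        rw [Finset.prod_mul_distrib, Finset.prod_const, (Finset.mem_powersetCard.1 hT).2]
    -- Summing over subsets of every size makes the sum factor as a product.
    _ ≤ ∑ T ∈ R.powerset, ∏ j ∈ T, t * p j :=
        Finset.sum_le_sum_of_subset_of_nonneg
          (fun T hT => Finset.mem_powerset.2 (Finset.mem_powersetCard.1 hT).1)
          fun T _ _ => Finset.prod_nonneg fun j _ => mul_nonneg ht (hp j)
    _ = ∏ j ∈ R, (1 + t * p j) := (Finset.prod_one_add R).symm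
    _ ≤ ∏ j ∈ R, Real.exp (t * p j) :=
        Finset.prod_le_prod (fun j _ => by have := mul_nonneg ht (hp j); linarith)
          fun j _ => by linarith [Real.add_one_le_exp (t * p j)]
    _ = Real.exp (t * ∑ j ∈ R, p j) := by rw [← Real.exp_sum, Finset.mul_sum]

section Alteration

variable {ι ρ : Type*} [DecidableEq ι] [Fintype ρ]

/-- At a vertex, the penalty polynomial counts the selected `k`-subsets of the row. -/
theorem sum_powersetCard_prod_indicator (R S : Finset ι) (k : ℕ) :
    ∑ T ∈ R.powersetCard k, ∏ j ∈ T, (if j ∈ S then (1 : ℝ) else 0) =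
      ((R ∩ S).card.choose k : ℝ) := by
  have h : ∀ T : Finset ι, ∏ j ∈ T, (if j ∈ S then (1 : ℝ) else 0) = if T ⊆ S then 1 else 0 := by
    intro T
    rw [Finset.prod_ite_zero]
    simp [Finset.subset_iff]
  simp only [h]
  rw [Finset.sum_boole, ← Finset.card_powersetCard]
  congr 2
  ext T
  simp only [Finset.mem_filter, Finset.mem_powersetCard, Finset.subset_inter_iff]
  tauto

/-- Deleting elements from violated rows: the weight penalised by the number of `(b + 1)`-subsets
of the rows is a lower bound for the weight of a subset that meets each row at most `b` times. -/
theorem exists_subset_card_inter_le (c : ι → ℝ) (hc : ∀ j, c j ≤ 1) (R : ρ → Finset ι) (b : ℕ)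
    (S : Finset ι) :
    ∃ S' ⊆ S, (∀ i, (R i ∩ S').card ≤ b) ∧
      ∑ j ∈ S, c j - ∑ i, ((R i ∩ S).card.choose (b + 1) : ℝ) ≤ ∑ j ∈ S', c j := by
  induction S using Finset.strongInduction with
  | H S ih =>
    by_cases h : ∀ i, (R i ∩ S).card ≤ b
    · refine ⟨S, subset_rfl, h, sub_le_self _ ?_⟩
      exact Finset.sum_nonneg fun _ _ => Nat.cast_nonneg _
    push Not at h
    obtain ⟨i, hi⟩ := h
    obtain ⟨j, hj⟩ : (R i ∩ S).Nonempty := Finset.card_pos.1 (by omega)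
    have hjS : j ∈ S := (Finset.mem_inter.1 hj).2
    obtain ⟨S', hS', hrow, hle⟩ := ih (S.erase j) (Finset.erase_ssubset hjS)
    refine ⟨S', hS'.trans (Finset.erase_subset _ _), hrow, le_trans ?_ hle⟩
    have hmono : ∀ i', ((R i' ∩ S.erase j).card.choose (b + 1)) ≤
        (R i' ∩ S).card.choose (b + 1) := fun i' =>
      Nat.choose_le_choose _ (Finset.card_le_card
        (Finset.inter_subset_inter_left (Finset.erase_subset _ _)))
    -- By Pascal's rule, the loss is the number of `b`-subsets of the remaining at least `b`
    -- elements, hence at least one; this pays for `c j ≤ 1`.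
    have hstrict : (R i ∩ S.erase j).card.choose (b + 1) + 1 ≤
        (R i ∩ S).card.choose (b + 1) := by
      have hcard : (R i ∩ S.erase j).card + 1 = (R i ∩ S).card := by
        rw [Finset.inter_erase, Finset.card_erase_add_one hj]
      rw [← hcard, Nat.choose_succ_succ, add_comm]
      exact Nat.add_le_add_right (Nat.choose_pos (by omega)) _
    have hsum : (∑ i', ((R i' ∩ S.erase j).card.choose (b + 1) : ℝ)) + 1 ≤
        ∑ i', ((R i' ∩ S).card.choose (b + 1) : ℝ) := by
      classical
      rw [← Finset.add_sum_erase _ _ (Finset.mem_univ i),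
        ← Finset.add_sum_erase (a := i) _ _ (Finset.mem_univ i)]
      have h1 : ((R i ∩ S.erase j).card.choose (b + 1) : ℝ) + 1 ≤
        (R i ∩ S).card.choose (b + 1) := by exact_mod_cast hstrict
      have h2 : ∑ i' ∈ Finset.univ.erase i, ((R i' ∩ S.erase j).card.choose (b + 1) : ℝ) ≤
          ∑ i' ∈ Finset.univ.erase i, ((R i' ∩ S).card.choose (b + 1) : ℝ) :=
        Finset.sum_le_sum fun i' _ => by exact_mod_cast hmono i'
      linarith
    have := Finset.add_sum_erase S c hjS
    linarith [hc j]

/-- Rounding a fractional point: the weight lost is at most the expected number of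
`(b + 1)`-subsets of the rows. -/
theorem exists_rounding_of_cube [Fintype ι] (c : ι → ℝ) (hc : ∀ j, c j ≤ 1) (R : ρ → Finset ι)
    (b : ℕ) (p : ι → ℝ) (hp : ∀ j, 0 ≤ p j ∧ p j ≤ 1) :
    ∃ S : Finset ι, (∀ j ∈ S, p j ≠ 0) ∧ (∀ i, (R i ∩ S).card ≤ b) ∧
      ∑ j, c j * p j - ∑ i, ∑ T ∈ (R i).powersetCard (b + 1), ∏ j ∈ T, p j ≤ ∑ j ∈ S, c j := by
  have hF : IsMultiaffine fun p : ι → ℝ =>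
      ∑ j, c j * p j - ∑ i, ∑ T ∈ (R i).powersetCard (b + 1), ∏ j ∈ T, p j :=
    (IsMultiaffine.sum _ fun j _ => (IsMultiaffine.apply j).const_mul (c j)).sub
      (IsMultiaffine.sum _ fun _ _ => IsMultiaffine.sum _ fun T _ => IsMultiaffine.prod T)
  obtain ⟨S, hS, hFS⟩ := hF.exists_vertex p hp
  obtain ⟨S', hS', hrow, hle⟩ := exists_subset_card_inter_le c hc R b S
  refine ⟨S', fun j hj => hS j (hS' hj), hrow, hFS.trans ?_⟩
  simpa [sum_powersetCard_prod_indicator] using hle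

end Alteration

theorem objective_nonneg {n : ℕ} {c x : Fin n → ℝ} (hc : ∀ j, 0 ≤ c j) (hx : ∀ j, 0 ≤ x j) :
    0 ≤ objective c x :=
  Finset.sum_nonneg fun j _ => mul_nonneg (hc j) (hx j)

/-- Rounding with respect to any scaling factor `s ≥ 1` with `m / OPT ≤ sᵇ`. -/
theorem exists_rounding_of_le_pow {m n : ℕ} {A : Matrix (Fin m) (Fin n) ℝ} {c x : Fin n → ℝ}
    {B : ℝ} {b : ℕ} {s : ℝ} (hA : IsZeroOne A) (hc : ∀ j, 0 ≤ c j ∧ c j ≤ 1) (hb : 1 ≤ b)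
    (hbB : (b : ℝ) ≤ B) (hBb : B ≤ b + 1) (hx : IsFractionalSolution A B x) (hs : 1 ≤ s)
    (hms : (m : ℝ) / objective c x ≤ s ^ b) :
    ∃ y : Fin n → ℝ, IsRounding x y ∧ ‖A *ᵥ y‖ ≤ B ∧
      7 / 256 * (objective c x / s) ≤ objective c y := by
  set OPT := objective c x with hOPT
  have hOPT0 : 0 ≤ OPT := objective_nonneg (fun j => (hc j).1) fun j => (hx.1 j).1
  have hs0 : 0 < s := by linarith
  have hB0 : 0 ≤ B := le_trans (Nat.cast_nonneg b) hbB
  have hm : (m : ℝ) ≤ s ^ b * OPT ∨ OPT = 0 := by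
    rcases hOPT0.eq_or_lt with h | h
    · exact Or.inr h.symm
    · exact Or.inl ((div_le_iff₀ h).1 hms)
  rcases hm with hm | h0
  -- If `OPT = 0`, then `m / OPT = 0` and `hms` says nothing about `m`; the zero vector suffices.
  swap
  · refine ⟨0, ⟨fun _ => Or.inl rfl, fun _ _ => rfl⟩, by simpa using hB0, ?_⟩
    simp [h0, objective]
  classical
  let R : Fin m → Finset (Fin n) := fun i => Finset.univ.filter fun j => A i j = 1
  have hmul : ∀ (i : Fin m) (z : Fin n → ℝ), (A *ᵥ z) i = ∑ j ∈ R i, z j := by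
    intro i z
    rw [Finset.sum_filter, Matrix.mulVec, dotProduct]
    refine Finset.sum_congr rfl fun j _ => ?_
    rcases hA i j with h | h <;> simp [h]
  have hp : ∀ j, 0 ≤ x j / (16 * s) ∧ x j / (16 * s) ≤ 1 := fun j =>
    ⟨div_nonneg (hx.1 j).1 (by positivity),
      (div_le_one (by positivity)).2 (by linarith [(hx.1 j).2])⟩
  obtain ⟨S, hS, hrow, hle⟩ := exists_rounding_of_cube c (fun j => (hc j).2) R b
    (fun j => x j / (16 * s)) hp
  refine ⟨fun j => if j ∈ S then 1 else 0, ⟨fun j => ?_, fun j hj => ?_⟩, ?_, ?_⟩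
  · by_cases h : j ∈ S <;> simp [h]
  · exact if_neg fun h => hS j h (by simp [hj])
  · refine (pi_norm_le_iff_of_nonneg hB0).2 fun i => ?_
    rw [hmul, Finset.sum_boole, Finset.filter_mem_eq_inter, Real.norm_of_nonneg (Nat.cast_nonneg _)]
    exact le_trans (by exact_mod_cast hrow i) hbB
  · have hobj : objective c (fun j => if j ∈ S then 1 else 0) = ∑ j ∈ S, c j := by
      simp [objective]
    have hlin : ∑ j, c j * (x j / (16 * s)) = OPT / (16 * s) := by
      rw [hOPT, objective, Finset.sum_div]
      exact Finset.sum_congr rfl fun j _ => by ring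
    have hpen : ∀ i, ∑ T ∈ (R i).powersetCard (b + 1), ∏ j ∈ T, x j / (16 * s) ≤
        (3 / (16 * s)) ^ (b + 1) := by
      intro i
      -- Taking `t = 16 s` undoes the scaling: the exponent becomes the row sum of `x`, at most `B ≤
      -- b + 1`.
      have h := pow_mul_sum_powersetCard_prod_le_exp (R i) (b + 1) (fun j => x j / (16 * s))
        (fun j => (hp j).1) (t := 16 * s) (by positivity)
      have hrowsum : 16 * s * ∑ j ∈ R i, x j / (16 * s) ≤ (b + 1 : ℕ) := by
        rw [← Finset.sum_div, mul_div_cancel₀ _ (by positivity), ← hmul]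
        push_cast
        exact (hx.2 i).trans hBb
      have hexp : Real.exp ((b + 1 : ℕ) : ℝ) ≤ 3 ^ (b + 1) := by
        rw [← Real.exp_one_pow]
        exact pow_le_pow_left₀ (Real.exp_pos 1).le (by linarith [Real.exp_one_lt_d9]) _
      rw [div_pow, le_div_iff₀ (by positivity), mul_comm]
      exact h.trans ((Real.exp_le_exp.2 hrowsum).trans hexp)
    have hpens : ∑ i, ∑ T ∈ (R i).powersetCard (b + 1), ∏ j ∈ T, x j / (16 * s) ≤
        9 / 256 * (OPT / s) := by
      calc _ ≤ ∑ _i : Fin m, (3 / (16 * s)) ^ (b + 1) := Finset.sum_le_sum fun i _ => hpen i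
        _ = m * (3 / (16 * s)) ^ (b + 1) := by simp
        _ ≤ s ^ b * OPT * (3 / (16 * s)) ^ (b + 1) :=
            mul_le_mul_of_nonneg_right hm (by positivity)
        _ = (3 / 16) ^ (b + 1) * (OPT / s) := by
            rw [div_pow, div_pow, mul_pow]
            field_simp
            ring
        -- Here `b ≥ 1` matters: the loss `9/256` must stay below the gain `1/16 = 16/256`, leaving
        -- `7/256`.
        _ ≤ (3 / 16) ^ 2 * (OPT / s) :=
            mul_le_mul_of_nonneg_right
              (pow_le_pow_of_le_one (by norm_num) (by norm_num) (by omega)) (by positivity)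
        _ = 9 / 256 * (OPT / s) := by norm_num
    rw [hobj]
    refine le_trans ?_ hle
    rw [hlin]
    have : OPT / (16 * s) = 1 / 16 * (OPT / s) := by field_simp
    linarith

theorem one_le_scaling (m : ℕ) (OPT : ℝ) (d : ℕ) (B : ℝ) : 1 ≤ scaling m OPT d B :=
  le_max_left _ _

/-- Since the scaling factor is at least one, the real exponent `B - 1` may be raised to the integer
`b`. -/
theorem div_le_scaling_pow {m : ℕ} {OPT : ℝ} (hOPT : 0 ≤ OPT) (d : ℕ) {B : ℝ} {b : ℕ}
    (hB : 1 < B) (hb : B - 1 ≤ b) : (m : ℝ) / OPT ≤ scaling m OPT d B ^ b := by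
  have h0 : (0 : ℝ) ≤ (m : ℝ) / OPT := by positivity
  have hB' : 0 < B - 1 := by linarith
  have h1 := one_le_scaling m OPT d B
  have h2 : ((m : ℝ) / OPT) ^ (1 / (B - 1)) ≤ scaling m OPT d B :=
    (le_max_left _ _).trans (le_max_right _ _)
  calc (m : ℝ) / OPT = (((m : ℝ) / OPT) ^ (1 / (B - 1))) ^ (B - 1) := by
        rw [← Real.rpow_mul h0, one_div_mul_cancel hB'.ne', Real.rpow_one]
    _ ≤ scaling m OPT d B ^ (B - 1) := Real.rpow_le_rpow (Real.rpow_nonneg h0 _) h2 hB'.le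
    _ ≤ scaling m OPT d B ^ (b : ℝ) := Real.rpow_le_rpow_of_exponent_le h1 hb
    _ = scaling m OPT d B ^ b := Real.rpow_natCast _ _

end PackingRounding

theorem mainTheorem5 :
    ∃ κ : ℝ, 0 < κ ∧
      (∀ (m n : ℕ) (A : Matrix (Fin m) (Fin n) ℝ) (c x : Fin n → ℝ) (U : Finset (Fin n)) (B : ℝ),
        PackingRounding.IsZeroOne A →
        (∀ j, 0 ≤ c j ∧ c j ≤ 1) →
        1 < B →
        PackingRounding.IsFractionalSolution A B x →
        ∃ y : Fin n → ℝ,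
          PackingRounding.IsRounding x y ∧
          ‖A *ᵥ y‖ ≤ B ∧
          κ * (PackingRounding.objective c x /
            PackingRounding.scaling m (PackingRounding.objective c x)
              (PackingRounding.dependencyDegree (PackingRounding.restrictColumns A U)) B) ≤
            PackingRounding.objective c y) ∧
      (∀ (m n : ℕ) (A : Matrix (Fin m) (Fin n) ℝ) (c x : Fin n → ℝ) (U : Finset (Fin n)) (B : ℤ),
        PackingRounding.IsZeroOne A →
        (∀ j, 0 ≤ c j ∧ c j ≤ 1) →
        1 ≤ B →
        PackingRounding.IsFractionalSolution A (B : ℝ) x →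
        ∃ y : Fin n → ℝ,
          PackingRounding.IsRounding x y ∧
          ‖A *ᵥ y‖ ≤ (B : ℝ) ∧
          κ * (PackingRounding.objective c x /
            PackingRounding.scaling m (PackingRounding.objective c x)
              (PackingRounding.dependencyDegree (PackingRounding.restrictColumns A U))
              ((B : ℝ) + 1)) ≤
            PackingRounding.objective c y) := by
  refine ⟨7 / 256, by norm_num, ?_, ?_⟩
  · intro m n A c x U B hA hc hB hx
    refine PackingRounding.exists_rounding_of_le_pow (b := ⌊B⌋₊) hA hc
      (Nat.one_le_floor_iff _ |>.2 hB.le) (Nat.floor_le (by linarith)) (Nat.lt_floor_add_one B).le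
      hx (PackingRounding.one_le_scaling _ _ _ _) (PackingRounding.div_le_scaling_pow
        (PackingRounding.objective_nonneg (fun j => (hc j).1) fun j => (hx.1 j).1) _ hB ?_)
    linarith [Nat.lt_floor_add_one B]
  · intro m n A c x U B hA hc hB hx
    lift B to ℕ using by omega
    have hB' : 1 ≤ B := by exact_mod_cast hB
    simp only [Int.cast_natCast] at hx ⊢
    have hpos : (0 : ℝ) < B := by exact_mod_cast hB'
    -- For integral `B`, `b = B` equals `(B + 1) - 1`, so the scaling factor may be taken at `B +
    -- 1`.
    exact PackingRounding.exists_rounding_of_le_pow (b := B) hA hc hB' le_rfl (by linarith)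
      hx (PackingRounding.one_le_scaling _ _ _ _) (PackingRounding.div_le_scaling_pow
        (PackingRounding.objective_nonneg (fun j => (hc j).1) fun j => (hx.1 j).1) _
        (by linarith) (by linarith))
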